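/- A group is called UCS if it has exactly one characteristic subgroup that is neither trivial nor the whole group, and a UCS $p$-group is a finite $p$-group that is UCS. Let $p\ge 3$ be a prime and let $m$ be a natural number with $m\equiv 2\pmod 4$ and $2m<p$. Let $V_m$ be the $\mathbb{F}_p$-space of homogeneous polynomials of degree $m$ in $\mathbb{F}_p[X,Y]$, on which $\mathrm{SL}(2,p)$ acts by linear substitutions $X\mapsto a_{11}X+a_{12}Y$, $Y\mapsto a_{21}X+a_{22}Y$. Then $V_m$ is an absolutely irreducible $\mathbb{F}_p\mathrm{SL}(2,p)$-module of dimension $m+1$, and there exists a UCS $p$-group $G$ of exponent $p^2$, with minimal number of generators $m+1$, such that: (1) the subgroup induced by $\mathrm{Aut}(G)$ on $G/\Phi(G)$, where $\Phi(G)$ is the Frattini subgroup, contains $\mathrm{SL}(2,p)$ in its representation on $V_m$; that is, there is an isomorphism $e\colon V_m\to G/\Phi(G)$ such that for every $A\in\mathrm{SL}(2,p)$ some automorphism of $G$ induces on $G/\Phi(G)$ the map $e\circ\rho(A)\circ e^{-1}$, where $\rho(A)$ is the action of $A$ on $V_m$; (2) $G$ is not isomorphic to a direct power $G_0^{\times k}$,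 $k\ge 0$, of a UCS $p$-group $G_0$ with $|G_0|<|G|$. -/

import Mathlib

universe u

/-- A group is UCS if it has a unique non-trivial proper characteristic subgroup. -/
def IsUCS (G : Type*) [Group G] : Prop :=
  ∃! N : Subgroup G, N.Characteristic ∧ N ≠ ⊥ ∧ N ≠ ⊤

/-- A finite UCS `p`-group. -/
structure IsUCSPGroup (p : ℕ) (G : Type*) [Group G] : Prop where
  finite : Finite G
  isPGroup : IsPGroup p G
  isUCS : IsUCS G

theorem map_frattini_mulAut {G : Type*} [Group G] (α : MulAut G) :
    (frattini G).map (α : G ≃* G).toMonoidHom = frattini G :=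
  Subgroup.characteristic_iff_map_eq.mp inferInstance α

/-- The action of `Aut(G)` on the Frattini quotient: `α` sends `g Φ(G)` to `α(g) Φ(G)`.
The range of this homomorphism is the group induced by `Aut(G)` on `G / Φ(G)`. -/
def autFrattiniQuotient (G : Type*) [Group G] : MulAut G →* MulAut (G ⧸ frattini G) where
  toFun α := QuotientGroup.congr (frattini G) (frattini G) α (map_frattini_mulAut α)
  map_one' := by
    ext x
    induction x using QuotientGroup.induction_on with
    | H g => rfl
  map_mul' α β := by
    ext x
    induction x using QuotientGroup.induction_on with
    | H g => rfl

/-- The linear substitution `X ↦ a₁₁ X + a₁₂ Y`, `Y ↦ a₂₁ X + a₂₂ Y` in the polynomial ring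
`F[X, Y]`; it is a right action of matrices: substituting `A` and then `B` amounts to
substituting `A * B`. -/
noncomputable def matSubst {F : Type*} [Field F] (A : Matrix (Fin 2) (Fin 2) F) :
    MvPolynomial (Fin 2) F →ₐ[F] MvPolynomial (Fin 2) F :=
  MvPolynomial.aeval fun i => ∑ j, A i j • MvPolynomial.X j

theorem matSubst_one {F : Type*} [Field F] :
    matSubst (1 : Matrix (Fin 2) (Fin 2) F) = AlgHom.id F _ := by
  apply MvPolynomial.algHom_ext
  intro i
  simp [matSubst, Matrix.one_apply]

theorem matSubst_comp {F : Type*} [Field F] (A B : Matrix (Fin 2) (Fin 2) F) :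
    (matSubst B).comp (matSubst A) = matSubst (A * B) := by
  apply MvPolynomial.algHom_ext
  intro i
  simp only [matSubst, AlgHom.comp_apply, MvPolynomial.aeval_X, map_sum, map_smul,
    Matrix.mul_apply, Finset.sum_smul, Finset.smul_sum, smul_smul]
  exact Finset.sum_comm

theorem matSubst_mem {F : Type*} [Field F] (A : Matrix (Fin 2) (Fin 2) F) (m : ℕ)
    (f : MvPolynomial (Fin 2) F) (hf : f ∈ MvPolynomial.homogeneousSubmodule (Fin 2) F m) :
    matSubst A f ∈ MvPolynomial.homogeneousSubmodule (Fin 2) F m := by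
  rw [MvPolynomial.mem_homogeneousSubmodule] at hf ⊢
  have h := hf.aeval (S := F) (n := 1) (fun i => ∑ j, A i j • MvPolynomial.X j) fun i =>
    (MvPolynomial.homogeneousSubmodule (Fin 2) F 1).sum_mem fun j _ =>
      Submodule.smul_mem _ _ (MvPolynomial.isHomogeneous_X F j)
  rwa [one_mul] at h

/-- The representation `V_m` of `SL(2, F)` on the homogeneous polynomials of degree `m` in
`F[X, Y]`, by linear substitutions. Representations are left actions, so `A` acts as the
substitution of `A⁻¹`. -/
noncomputable def slForms (F : Type*) [Field F] (m : ℕ) :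
    Representation F (Matrix.SpecialLinearGroup (Fin 2) F)
      (MvPolynomial.homogeneousSubmodule (Fin 2) F m) where
  toFun A := (matSubst ((A⁻¹ : Matrix.SpecialLinearGroup (Fin 2) F) :
    Matrix (Fin 2) (Fin 2) F)).toLinearMap.restrict (matSubst_mem _ m)
  map_one' := by
    ext f : 2
    simp [matSubst_one]
  map_mul' A B := by
    ext f : 2
    simp [← matSubst_comp]

/-- A representation over a field `F` is absolutely irreducible if it is irreducible after
every extension of scalars `K / F`. -/
def IsAbsolutelyIrreducible {F : Type u} {G V : Type*} [Field F] [Group G] [AddCommGroup V]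
    [Module F V] (ρ : Representation F G V) : Prop :=
  ∀ (K : Type u) [Field K] [Algebra F K],
    Representation.IsIrreducible
      (((Module.End.baseChangeHom F K V : Module.End F V →* Module.End K (TensorProduct F K V)).comp
        ρ : Representation K G (TensorProduct F K V)))

/-! Put `m = 2k`; the congruence on `m` says that `k` is odd. The transvectant of order `k` sends
two forms of degree `2k` to a form of degree `2k`, commutes with `SL(2)`, and has sign `(-1)^k = -1`
under exchange of its arguments. It thus makes `V = V_m` an alternating, usually non-Lie, algebra on
which `SL(2,p)` acts by automorphisms.

Let `A = (ℤ/p²)^(m+1)`, so that `A/pA ≃ V ≃ pA`. The law `x + y + p[x̄, ȳ]` makes `A` a group `G` of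
class at most two in which the `p`-th power of `x` is `px`. Entrywise lifting of matrices turns each
element of `SL(2,p)` into an automorphism of `G`. The power map identifies the two layers `G/pA` and
`pA` equivariantly, and `V` is irreducible; hence `pA` is the Frattini subgroup and the only proper
non-trivial characteristic subgroup.

A direct factorization of `G` would split `V` into two ideals. The polarizations `X_i ∂/∂X_j` are
derivations of the algebra, and its centre is zero, so they preserve such ideals; by irreducibility
one ideal is zero. A direct power with at least two non-trivial factors is therefore impossible.

Irreducibility is proved for the polarizations, which raise and lower the monomial basis, and passes
to the group because they are linear combinations of elements of `SL(2,p)`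
(`formsPolarization_eq_sum`). -/

open MvPolynomial

/-! ### Transvectants: symmetry, equivariance, non-vanishing -/

/-- The transvectant (Gordan bracket) of order `k` of two binary forms. -/
noncomputable def transvectant (F : Type*) [Field F] : ℕ →
    MvPolynomial (Fin 2) F →ₗ[F] MvPolynomial (Fin 2) F →ₗ[F] MvPolynomial (Fin 2) F
  | 0 => LinearMap.mul F _
  | k + 1 =>
    (transvectant F k).compl₁₂ (pderiv 0).toLinearMap (pderiv 1).toLinearMap -
      (transvectant F k).compl₁₂ (pderiv 1).toLinearMap (pderiv 0).toLinearMap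

/-- The polarization operator `X_i ∂/∂X_j`. -/
noncomputable def polarization {F : Type*} [Field F] (i j : Fin 2) :
    MvPolynomial (Fin 2) F →ₗ[F] MvPolynomial (Fin 2) F :=
  LinearMap.mulLeft F (X i) ∘ₗ (pderiv j).toLinearMap

section Transvectant

variable {F : Type*} [Field F]

theorem polarization_apply (i j : Fin 2) (f : MvPolynomial (Fin 2) F) :
    polarization i j f = X i * pderiv j f := rfl

@[simp]
theorem transvectant_zero (f g : MvPolynomial (Fin 2) F) : transvectant F 0 f g = f * g := rfl

theorem transvectant_succ (k : ℕ) (f g : MvPolynomial (Fin 2) F) :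
    transvectant F (k + 1) f g =
      transvectant F k (pderiv 0 f) (pderiv 1 g) - transvectant F k (pderiv 1 f) (pderiv 0 g) :=
  rfl

theorem transvectant_swap (k : ℕ) (f g : MvPolynomial (Fin 2) F) :
    transvectant F k g f = (-1) ^ k * transvectant F k f g := by
  induction k generalizing f g with
  | zero => simp [mul_comm]
  | succ k ih =>
    rw [transvectant_succ, transvectant_succ, ih (pderiv 1 f), ih (pderiv 0 f)]
    ring

theorem pderiv_pderiv_comm (i j : Fin 2) (f : MvPolynomial (Fin 2) F) :
    pderiv i (pderiv j f) = pderiv j (pderiv i f) := by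
  have h : ⁅pderiv (R := F) i, pderiv (R := F) j⁆ = 0 := by
    refine MvPolynomial.derivation_ext fun l => ?_
    rw [Derivation.commutator_apply, pderiv_X, pderiv_X, Pi.single_apply, Pi.single_apply]
    split_ifs <;> simp
  have := DFunLike.congr_fun h f
  rwa [Derivation.commutator_apply, Derivation.zero_apply, sub_eq_zero] at this

theorem pderiv_polarization (l i j : Fin 2) (f : MvPolynomial (Fin 2) F) :
    pderiv l (polarization i j f) =
      polarization i j (pderiv l f) + (if l = i then pderiv j f else 0) := by
  rw [polarization_apply, polarization_apply, pderiv_mul, pderiv_X, Pi.single_apply,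
    pderiv_pderiv_comm l j]
  by_cases h : l = i
  · subst h
    simp [add_comm]
  · simp [h, Ne.symm h]

/-- Commuting `X_i ∂_j` past `∂_0 ⊗ ∂_1 - ∂_1 ⊗ ∂_0` leaves correction terms that cancel when the
polarization has trace zero, hence the condition `i ≠ j`. -/
theorem polarization_transvectant {i j : Fin 2} (hij : i ≠ j) (k : ℕ)
    (f g : MvPolynomial (Fin 2) F) :
    polarization i j (transvectant F k f g) =
      transvectant F k (polarization i j f) g + transvectant F k f (polarization i j g) := by
  induction k generalizing f g with
  | zero =>
    simp only [transvectant_zero, polarization_apply, pderiv_mul]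
    ring
  | succ k ih =>
    simp only [transvectant_succ, map_sub, ih, pderiv_polarization, map_add, LinearMap.add_apply]
    fin_cases i <;> fin_cases j <;> simp at hij ⊢ <;> abel

theorem pderiv_matSubst (A : Matrix (Fin 2) (Fin 2) F) (j : Fin 2)
    (f : MvPolynomial (Fin 2) F) :
    pderiv j (matSubst A f) = ∑ i, A i j • matSubst A (pderiv i f) := by
  induction f using MvPolynomial.induction_on with
  | C a => simp [matSubst]
  | add f g hf hg => simp only [map_add, hf, hg, smul_add, Finset.sum_add_distrib]
  | mul_X f l hf =>
    simp only [map_mul, pderiv_mul, hf, map_add, Fin.sum_univ_two]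
    have h : pderiv j (matSubst A (X l)) = C (A l j) := by
      fin_cases j <;> simp [matSubst, Fin.sum_univ_two, pderiv_X, smul_eq_C_mul]
    rw [h]
    fin_cases l <;> simp [smul_eq_C_mul, pderiv_X] <;> ring

/-- By the chain rule, each application of `∂_0 ⊗ ∂_1 - ∂_1 ⊗ ∂_0` contributes one factor `det A`.
-/
theorem transvectant_matSubst (A : Matrix (Fin 2) (Fin 2) F) (k : ℕ)
    (f g : MvPolynomial (Fin 2) F) :
    transvectant F k (matSubst A f) (matSubst A g) =
      A.det ^ k • matSubst A (transvectant F k f g) := by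
  induction k generalizing f g with
  | zero => simp
  | succ k ih =>
    simp only [transvectant_succ, pderiv_matSubst, Fin.sum_univ_two, map_add, map_smul,
      LinearMap.add_apply, LinearMap.smul_apply, ih, map_sub, Matrix.det_fin_two, pow_succ]
    simp only [smul_eq_C_mul, map_mul, map_sub, map_pow]
    ring

theorem isHomogeneous_transvectant (k : ℕ) {a b : ℕ} {f g : MvPolynomial (Fin 2) F}
    (hf : f.IsHomogeneous a) (hg : g.IsHomogeneous b) :
    (transvectant F k f g).IsHomogeneous ((a - k) + (b - k)) := by
  induction k generalizing f g a b with
  | zero => exact hf.mul hg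
  | succ k ih =>
    rw [transvectant_succ, Nat.add_comm k 1, ← Nat.sub_sub, ← Nat.sub_sub]
    exact (ih hf.pderiv hg.pderiv).sub (ih hf.pderiv hg.pderiv)

theorem transvectant_X_pow (k a : ℕ) (g : MvPolynomial (Fin 2) F) :
    transvectant F k (X 0 ^ a) g =
      (a.descFactorial k : MvPolynomial (Fin 2) F) * X 0 ^ (a - k) * (pderiv 1)^[k] g := by
  induction k generalizing a g with
  | zero => simp
  | succ k ih =>
    have h0 : pderiv 0 (X 0 ^ a : MvPolynomial (Fin 2) F) = a • X 0 ^ (a - 1) := by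
      simp
    have h1 : pderiv 1 (X 0 ^ a : MvPolynomial (Fin 2) F) = 0 := by
      simp [pderiv_X]
    rw [transvectant_succ, h0, h1, map_zero, LinearMap.zero_apply, sub_zero, map_nsmul,
      LinearMap.smul_apply, ih, Function.iterate_succ_apply, Nat.sub_sub, Nat.add_comm 1 k]
    cases a with
    | zero => simp
    | succ a =>
      rw [Nat.succ_descFactorial_succ, Nat.add_sub_cancel]
      simp only [nsmul_eq_mul]
      push_cast
      ring

theorem iterate_pderiv_X_pow (k a : ℕ) :
    (pderiv 1)^[k] (X 1 ^ a : MvPolynomial (Fin 2) F) =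
      (a.descFactorial k : MvPolynomial (Fin 2) F) * X 1 ^ (a - k) := by
  induction k with
  | zero => simp
  | succ k ih =>
    rw [Function.iterate_succ_apply', ih, Nat.descFactorial_succ, pderiv_mul, pderiv_pow,
      pderiv_X_self, Nat.sub_sub]
    have : pderiv 1 ((a.descFactorial k : ℕ) : MvPolynomial (Fin 2) F) = 0 := by simp
    rw [this]
    push_cast
    ring

/-- The falling factorial divides `m!`, which is prime to `p` as `m < p`. -/
theorem natCast_descFactorial_ne_zero {p : ℕ} (hp : p.Prime) [CharP F p] {m : ℕ} (hm : m < p)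
    {k : ℕ} (hk : k ≤ m) : (m.descFactorial k : F) ≠ 0 := by
  rw [Ne, CharP.cast_eq_zero_iff F p]
  intro h
  have := (h.trans (Dvd.intro_left _ (Nat.factorial_mul_descFactorial hk)))
  exact absurd ((Nat.Prime.dvd_factorial hp).mp this) (by omega)

theorem transvectant_ne_zero {p : ℕ} (hp : p.Prime) [CharP F p] {m : ℕ} (hm : m < p)
    {k : ℕ} (hk : k ≤ m) :
    transvectant F k (X 0 ^ m) (X 1 ^ m) ≠ 0 := by
  rw [transvectant_X_pow, iterate_pderiv_X_pow]
  have h := natCast_descFactorial_ne_zero (F := F) hp hm hk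
  have h' : ((m.descFactorial k : ℕ) : MvPolynomial (Fin 2) F) ≠ 0 := by
    rw [← map_natCast (C : F →+* MvPolynomial (Fin 2) F), Ne, map_eq_zero_iff _ (C_injective _ _)]
    exact h
  exact mul_ne_zero (mul_ne_zero h' (pow_ne_zero _ (X_ne_zero _)))
    (mul_ne_zero h' (pow_ne_zero _ (X_ne_zero _)))

end Transvectant

/-! ### Irreducibility from ladder operators -/

/-- Irreducibility of a module with a basis on which a lowering and a raising operator act by
non-zero scalars. -/
theorem Submodule.eq_bot_or_eq_top_of_ladder {K M : Type*} [Field K] [AddCommGroup M] [Module K M]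
    {m : ℕ} (b : Module.Basis (Fin (m + 1)) K M) (D U : M →ₗ[K] M) (d u : Fin m → K)
    (hd : ∀ i, d i ≠ 0) (hu : ∀ i, u i ≠ 0) (hD0 : D (b 0) = 0)
    (hD : ∀ i : Fin m, D (b i.succ) = d i • b i.castSucc)
    (hU : ∀ i : Fin m, U (b i.castSucc) = u i • b i.succ)
    (W : Submodule K M) (hWD : ∀ w ∈ W, D w ∈ W) (hWU : ∀ w ∈ W, U w ∈ W) :
    W = ⊥ ∨ W = ⊤ := by
  have hrepr : ∀ (i : Fin m) (w : M), b.repr (D w) i.castSucc = d i * b.repr w i.succ := by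
    intro i w
    have : (b.coord i.castSucc) ∘ₗ D = d i • b.coord i.succ := by
      refine b.ext fun j => ?_
      induction j using Fin.cases with
      | zero => simp [hD0]
      | succ j =>
        by_cases h : j = i
        · subst h
          simp [hD]
        · simp [hD, h]
    exact LinearMap.congr_fun this w
  have hlast : ∀ w : M, b.repr (D w) (Fin.last m) = 0 := by
    intro w
    have : (b.coord (Fin.last m)) ∘ₗ D = 0 := by
      refine b.ext fun j => ?_
      induction j using Fin.cases with
      | zero => simp [hD0]
      | succ j => simp [hD, (Fin.castSucc_lt_last j).ne]
    exact LinearMap.congr_fun this w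
  -- Induction on a bound `n` for the top index occurring in `w`: if the coefficient at `n + 1` is
  -- non-zero, `D` moves it to a non-zero coefficient at `n`, so the process ends at a multiple of
  -- `b 0`.
  have key : ∀ n : ℕ, ∀ w ∈ W, w ≠ 0 → (∀ i : Fin (m + 1), n < i → b.repr w i = 0) → b 0 ∈ W := by
    intro n
    induction n with
    | zero =>
      intro w hw hw0 h
      have hs : w = b.repr w 0 • b 0 := by
        conv_lhs => rw [← b.sum_repr w, Fin.sum_univ_succ]
        simp [h]
      have hc : b.repr w 0 ≠ 0 := by
        intro hc
        rw [hc, zero_smul] at hs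
        exact hw0 hs
      rw [hs] at hw
      exact (W.smul_mem_iff hc).mp hw
    | succ n ih =>
      intro w hw hw0 h
      by_cases hn : n < m
      · by_cases hc : b.repr w (Fin.succ ⟨n, hn⟩) = 0
        · refine ih w hw hw0 fun i hi => ?_
          rcases Nat.lt_or_ge (n + 1) i with h' | h'
          · exact h i h'
          · have : i = Fin.succ ⟨n, hn⟩ := Fin.ext (by simp; omega)
            rw [this, hc]
        · refine ih (D w) (hWD w hw) ?_ fun i hi => ?_
          · intro h0
            have := hrepr ⟨n, hn⟩ w
            rw [h0, map_zero, Finsupp.zero_apply] at this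
            exact mul_ne_zero (hd _) hc this.symm
          · induction i using Fin.lastCases with
            | last => exact hlast w
            | cast i =>
              rw [hrepr, h i.succ (by simpa using hi), mul_zero]
      · exact ih w hw hw0 fun i hi => absurd i.isLt (by omega)
  by_cases h : W = ⊥
  · exact Or.inl h
  · obtain ⟨w, hw, hw0⟩ := W.exists_mem_ne_zero_of_ne_bot h
    have h0 : b 0 ∈ W := key m w hw hw0 fun i hi => absurd i.isLt (by omega)
    right
    rw [eq_top_iff, ← b.span_eq, Submodule.span_le]
    rintro _ ⟨i, rfl⟩
    induction i using Fin.induction with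
    | zero => exact h0
    | succ i ih =>
      have := hWU _ ih
      rw [hU] at this
      exact (W.smul_mem_iff (hu i)).mp this

/-! ### Binary forms: monomial basis and polarizations -/

section Forms

variable (F : Type*) [Field F] (m : ℕ)

/-- The space `V_m` of binary forms of degree `m`. -/
abbrev Forms : Type _ := homogeneousSubmodule (Fin 2) F m

/-- The exponent of the monomial `X^(m-i) Y^i`. -/
noncomputable def formExponent (i : Fin (m + 1)) : Fin 2 →₀ ℕ :=
  Finsupp.single 0 (m - i) + Finsupp.single 1 (i : ℕ)

theorem formExponent_degree (i : Fin (m + 1)) : (formExponent m i).degree = m := by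
  rw [Finsupp.degree_eq_sum, Fin.sum_univ_two]
  simp [formExponent]
  omega

theorem formExponent_injective : Function.Injective (formExponent m) := by
  intro i j h
  have := DFunLike.congr_fun h 1
  simp [formExponent] at this
  exact Fin.ext this

theorem exists_formExponent {d : Fin 2 →₀ ℕ} (hd : d.degree = m) :
    ∃ i, formExponent m i = d := by
  rw [Finsupp.degree_eq_sum, Fin.sum_univ_two] at hd
  refine ⟨⟨d 1, by omega⟩, ?_⟩
  ext l
  fin_cases l <;> simp [formExponent]
  omega

/-- A binary form of degree `m` is determined by its `m + 1` coefficients. -/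
noncomputable def formsEquiv : Forms F m ≃ₗ[F] (Fin (m + 1) → F) :=
  LinearEquiv.ofBijective
    (LinearMap.pi fun i => (MvPolynomial.lcoeff F (formExponent m i)).comp (Submodule.subtype _)) <| by
    constructor
    · rw [← LinearMap.ker_eq_bot, LinearMap.ker_eq_bot']
      intro f hf
      ext d
      by_cases hd : d.degree = m
      · obtain ⟨i, rfl⟩ := exists_formExponent m hd
        exact congr_fun hf i
      · exact IsHomogeneous.coeff_eq_zero f.2 hd
    · intro c
      refine ⟨∑ i, c i • ⟨monomial (formExponent m i) 1,
        isHomogeneous_monomial _ (formExponent_degree m i)⟩, ?_⟩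
      ext i
      simp [coeff_monomial, (formExponent_injective m).eq_iff]

/-- The basis of monomials `X^(m-i) Y^i` of `V_m`. -/
noncomputable def formsBasis : Module.Basis (Fin (m + 1)) F (Forms F m) :=
  Module.Basis.ofEquivFun (formsEquiv F m)

theorem coe_formsBasis (i : Fin (m + 1)) :
    (formsBasis F m i : MvPolynomial (Fin 2) F) = X 0 ^ (m - (i : ℕ)) * X 1 ^ (i : ℕ) := by
  have h : formsBasis F m i = ⟨monomial (formExponent m i) 1,
      isHomogeneous_monomial _ (formExponent_degree m i)⟩ := by
    rw [formsBasis, Module.Basis.coe_ofEquivFun, LinearEquiv.symm_apply_eq]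
    ext j
    change _ = coeff (formExponent m j) (monomial (formExponent m i) 1)
    simp [coeff_monomial, (formExponent_injective m).eq_iff, Pi.single_apply, eq_comm]
  rw [h]
  simp [formExponent, monomial_eq, Finsupp.prod_add_index', Finsupp.prod_single_index, pow_add]

theorem finrank_forms : Module.finrank F (Forms F m) = m + 1 := by
  rw [Module.finrank_eq_card_basis (formsBasis F m), Fintype.card_fin]

variable {F}

theorem polarization_mem {i j : Fin 2} {f : MvPolynomial (Fin 2) F} (hm : m ≠ 0)
    (hf : f ∈ homogeneousSubmodule (Fin 2) F m) :
    polarization i j f ∈ homogeneousSubmodule (Fin 2) F m := by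
  have h : IsHomogeneous f m := hf
  have := (isHomogeneous_X F i).mul (h.pderiv (i := j))
  rwa [Nat.add_sub_cancel' (Nat.one_le_iff_ne_zero.mpr hm)] at this

variable (F) in
/-- The polarization operator on `V_m`. -/
noncomputable def formsPolarization (i j : Fin 2) (hm : m ≠ 0) : Forms F m →ₗ[F] Forms F m :=
  (polarization i j).restrict fun _ => polarization_mem m hm

theorem coe_formsPolarization (i j : Fin 2) (hm : m ≠ 0) (f : Forms F m) :
    (formsPolarization F m i j hm f : MvPolynomial (Fin 2) F) = polarization i j f := rfl

theorem formsPolarization_basis_zero (hm : m ≠ 0) :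
    formsPolarization F m 0 1 hm (formsBasis F m 0) = 0 := by
  ext1
  simp [coe_formsPolarization, coe_formsBasis, polarization_apply, pderiv_X]

theorem formsPolarization_basis_succ (hm : m ≠ 0) (i : Fin m) :
    formsPolarization F m 0 1 hm (formsBasis F m i.succ) =
      ((i + 1 : ℕ) : F) • formsBasis F m i.castSucc := by
  ext1
  have h : m - (i : ℕ) = m - (i + 1) + 1 := by omega
  simp only [coe_formsPolarization, coe_formsBasis, polarization_apply, pderiv_mul, pderiv_pow,
    pderiv_X_self, pderiv_X_of_ne (show (0 : Fin 2) ≠ 1 by decide), Submodule.coe_smul,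
    smul_eq_C_mul, Fin.val_succ, Fin.val_castSucc, map_natCast, h, Nat.add_sub_cancel]
  ring

theorem formsPolarization_basis_castSucc (hm : m ≠ 0) (i : Fin m) :
    formsPolarization F m 1 0 hm (formsBasis F m i.castSucc) =
      ((m - i : ℕ) : F) • formsBasis F m i.succ := by
  ext1
  have h : m - (i : ℕ) - 1 = m - (i + 1) := by omega
  simp only [coe_formsPolarization, coe_formsBasis, polarization_apply, pderiv_mul, pderiv_pow,
    pderiv_X_self, pderiv_X_of_ne (show (1 : Fin 2) ≠ 0 by decide), Submodule.coe_smul,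
    smul_eq_C_mul, Fin.val_succ, Fin.val_castSucc, map_natCast, h]
  ring

/-- Over any extension of the field of `p > m` elements, a subspace of `V_m` that is stable under
both polarizations is trivial. -/
theorem eq_bot_or_eq_top_of_baseChange_polarization {p : ℕ} [CharP F p] (hm : m ≠ 0)
    (hmp : m < p) (K : Type*) [Field K] [Algebra F K] (W : Submodule K (TensorProduct F K (Forms F m)))
    (hD : ∀ w ∈ W, (formsPolarization F m 0 1 hm).baseChange K w ∈ W)
    (hU : ∀ w ∈ W, (formsPolarization F m 1 0 hm).baseChange K w ∈ W) : W = ⊥ ∨ W = ⊤ := by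
  have hne : ∀ n : ℕ, n ≠ 0 → n ≤ m → algebraMap F K (n : F) ≠ 0 := by
    intro n h0 hn
    rw [Ne, map_eq_zero, CharP.cast_eq_zero_iff F p]
    exact fun h => absurd (Nat.le_of_dvd (by omega) h) (by omega)
  refine Submodule.eq_bot_or_eq_top_of_ladder ((formsBasis F m).baseChange K) _ _
    (fun i => algebraMap F K (i + 1 : ℕ)) (fun i => algebraMap F K (m - i : ℕ))
    (fun i => hne _ (by omega) (by omega)) (fun i => hne _ (by omega) (by omega)) ?_ ?_ ?_ W hD hU
  · rw [Module.Basis.baseChange_apply, LinearMap.baseChange_tmul, formsPolarization_basis_zero,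
      TensorProduct.tmul_zero]
  · intro i
    rw [Module.Basis.baseChange_apply, LinearMap.baseChange_tmul, formsPolarization_basis_succ,
      Module.Basis.baseChange_apply, algebraMap_smul, TensorProduct.tmul_smul]
  · intro i
    rw [Module.Basis.baseChange_apply, LinearMap.baseChange_tmul, formsPolarization_basis_castSucc,
      Module.Basis.baseChange_apply, algebraMap_smul, TensorProduct.tmul_smul]

theorem eq_bot_or_eq_top_of_polarization {p : ℕ} [CharP F p] (hm : m ≠ 0)
    (hmp : m < p) (W : Submodule F (Forms F m))
    (hD : ∀ w ∈ W, formsPolarization F m 0 1 hm w ∈ W)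
    (hU : ∀ w ∈ W, formsPolarization F m 1 0 hm w ∈ W) : W = ⊥ ∨ W = ⊤ := by
  have hne : ∀ n : ℕ, n ≠ 0 → n ≤ m → (n : F) ≠ 0 := by
    intro n h0 hn
    rw [Ne, CharP.cast_eq_zero_iff F p]
    exact fun h => absurd (Nat.le_of_dvd (by omega) h) (by omega)
  exact Submodule.eq_bot_or_eq_top_of_ladder (formsBasis F m) _ _
    (fun i => ((i + 1 : ℕ) : F)) (fun i => ((m - i : ℕ) : F))
    (fun i => hne _ (by omega) (by omega)) (fun i => hne _ (by omega) (by omega))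
    (formsPolarization_basis_zero m hm) (formsPolarization_basis_succ m hm)
    (formsPolarization_basis_castSucc m hm) W hD hU

end Forms

/-! ### From polarizations to `SL(2, p)` -/

/-- Power sums over the field vanish unless the exponent is a positive multiple of `p - 1`. So the
weights `-t^(p-2)` extract the coefficient of `t` from a polynomial in `t` of small degree. -/
theorem ZMod.sum_pow_sub_two_add {p : ℕ} [Fact p.Prime] {l : ℕ} (hl : l + 1 < p) :
    ∑ t : ZMod p, t ^ (p - 2 + l) = if l = 1 then -1 else 0 := by
  have hp : 2 ≤ p := (Fact.out : p.Prime).two_le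
  rcases Nat.lt_trichotomy l 1 with h | h | h
  · rw [if_neg h.ne, FiniteField.sum_pow_lt_card_sub_one]
    rw [ZMod.card]
    omega
  · subst h
    have : ∀ t : ZMod p, t ^ (p - 2 + 1) = 1 - if t = 0 then 1 else 0 := by
      intro t
      rw [show p - 2 + 1 = p - 1 by omega]
      split_ifs with ht
      · rw [ht, zero_pow (by omega), sub_self]
      · rw [ZMod.pow_card_sub_one_eq_one ht, sub_zero]
    simp [this, Finset.sum_sub_distrib]
  · have : ∀ t : ZMod p, t ^ (p - 2 + l) = t ^ (l - 1) := by
      intro t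
      by_cases ht : t = 0
      · rw [ht, zero_pow (by omega), zero_pow (by omega)]
      · rw [show p - 2 + l = p - 1 + (l - 1) by omega, pow_add, ZMod.pow_card_sub_one_eq_one ht,
          one_mul]
    rw [if_neg h.ne', Finset.sum_congr rfl fun t _ => this t, FiniteField.sum_pow_lt_card_sub_one]
    rw [ZMod.card]
    omega

/-- The elementary matrix of the substitution `X_j ↦ X_j + t X_i`, `X_i ↦ X_i`. -/
def elementarySL {F : Type*} [Field F] {i j : Fin 2} (hij : i ≠ j) (t : F) :
    Matrix.SpecialLinearGroup (Fin 2) F :=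
  ⟨Matrix.transvection j i t, Matrix.det_transvection_of_ne j i hij.symm t⟩

section Span

variable {p : ℕ} [Fact p.Prime]

theorem matSubst_elementarySL {F : Type*} [Field F] {i j : Fin 2} (hij : i ≠ j) (t : F) (a b : ℕ) :
    matSubst (elementarySL hij t : Matrix (Fin 2) (Fin 2) F) (X i ^ a * X j ^ b) =
      X i ^ a * (t • X i + X j) ^ b := by
  have : ∀ l, matSubst (elementarySL hij t : Matrix (Fin 2) (Fin 2) F) (X l) =
      X l + if l = j then t • X i else 0 := by
    intro l
    fin_cases i <;> fin_cases j <;> first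
      | exact absurd rfl hij
      | (fin_cases l <;>
          simp [matSubst, elementarySL, Matrix.transvection, Matrix.one_apply, Matrix.single_apply] <;> ring)
  rw [map_mul, map_pow, map_pow, this, this, if_neg hij, if_pos rfl, add_zero, add_comm (X j)]

/-- The substitution `X_j ↦ X_j + t X_i` is polynomial in `t`, and its linear coefficient is the
polarization. -/
theorem sum_matSubst_elementarySL {i j : Fin 2} (hij : i ≠ j) {a b : ℕ} (hb : b + 1 < p) :
    -∑ t : ZMod p, t ^ (p - 2) •
        matSubst (elementarySL hij t : Matrix (Fin 2) (Fin 2) (ZMod p)) (X i ^ a * X j ^ b) =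
      polarization i j (X i ^ a * X j ^ b) := by
  have hpol : polarization i j (X i ^ a * X j ^ b : MvPolynomial (Fin 2) (ZMod p)) =
      (b : MvPolynomial (Fin 2) (ZMod p)) * (X i ^ (a + 1) * X j ^ (b - 1)) := by
    simp only [polarization_apply, pderiv_mul, pderiv_pow, pderiv_X_self, pderiv_X_of_ne hij]
    ring
  have h : ∀ t : ZMod p, t ^ (p - 2) •
      matSubst (elementarySL hij t : Matrix (Fin 2) (Fin 2) (ZMod p)) (X i ^ a * X j ^ b) =
      ∑ l ∈ Finset.range (b + 1), t ^ (p - 2 + l) •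
        ((b.choose l : MvPolynomial (Fin 2) (ZMod p)) * (X i ^ (a + l) * X j ^ (b - l))) := by
    intro t
    rw [matSubst_elementarySL, add_pow, Finset.mul_sum, Finset.smul_sum]
    refine Finset.sum_congr rfl fun l _ => ?_
    simp only [smul_eq_C_mul, map_pow]
    ring
  rw [Finset.sum_congr rfl fun t _ => h t, Finset.sum_comm, hpol]
  simp only [← Finset.sum_smul]
  have h2 : ∀ l ∈ Finset.range (b + 1), (∑ t : ZMod p, t ^ (p - 2 + l)) •
        ((b.choose l : MvPolynomial (Fin 2) (ZMod p)) * (X i ^ (a + l) * X j ^ (b - l))) =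
      if l = 1 then -((b : MvPolynomial (Fin 2) (ZMod p)) * (X i ^ (a + 1) * X j ^ (b - 1))) else 0 := by
    intro l hl
    rw [ZMod.sum_pow_sub_two_add (by have := Finset.mem_range.mp hl; omega)]
    split_ifs with h
    · subst h
      simp
    · simp
  rw [Finset.sum_congr rfl h2, Finset.sum_ite_eq']
  cases b with
  | zero => simp
  | succ b => simp

theorem coe_slForms_inv (m : ℕ) (A : Matrix.SpecialLinearGroup (Fin 2) (ZMod p))
    (f : Forms (ZMod p) m) :
    (slForms (ZMod p) m A⁻¹ f : MvPolynomial (Fin 2) (ZMod p)) =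
      matSubst (A : Matrix (Fin 2) (Fin 2) (ZMod p)) f := by
  change matSubst ((A⁻¹⁻¹ : Matrix.SpecialLinearGroup (Fin 2) (ZMod p)) :
    Matrix (Fin 2) (Fin 2) (ZMod p)) f = _
  rw [inv_inv]

/-- The polarizations lie in the enveloping algebra of `SL(2, p)` on `V_m`. -/
theorem formsPolarization_eq_sum {m : ℕ} (hm : m ≠ 0) (hmp : m + 1 < p) {i j : Fin 2}
    (hij : i ≠ j) :
    formsPolarization (ZMod p) m i j hm =
      -∑ t : ZMod p, t ^ (p - 2) • slForms (ZMod p) m (elementarySL hij t)⁻¹ := by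
  refine (formsBasis (ZMod p) m).ext fun l => ?_
  ext1
  simp only [LinearMap.neg_apply, LinearMap.sum_apply, LinearMap.smul_apply, Submodule.coe_neg,
    Submodule.coe_sum, Submodule.coe_smul, coe_slForms_inv, coe_formsPolarization]
  rw [coe_formsBasis]
  have hl := l.isLt
  rcases (show (i = 0 ∧ j = 1) ∨ (i = 1 ∧ j = 0) by omega) with ⟨rfl, rfl⟩ | ⟨rfl, rfl⟩
  · rw [sum_matSubst_elementarySL hij (by omega)]
  · rw [mul_comm (X 0 ^ _), sum_matSubst_elementarySL hij (by omega)]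

theorem eq_bot_or_eq_top_of_slForms {m : ℕ} (hm : m ≠ 0) (hmp : m + 1 < p)
    (W : Submodule (ZMod p) (Forms (ZMod p) m))
    (hW : ∀ A, ∀ w ∈ W, slForms (ZMod p) m A w ∈ W) : W = ⊥ ∨ W = ⊤ := by
  have h : ∀ i j : Fin 2, i ≠ j → ∀ w ∈ W, formsPolarization (ZMod p) m i j hm w ∈ W := by
    intro i j hij w hw
    rw [formsPolarization_eq_sum hm hmp hij]
    simp only [LinearMap.neg_apply, LinearMap.sum_apply, LinearMap.smul_apply]
    exact W.neg_mem (W.sum_mem fun t _ => W.smul_mem _ (hW _ _ hw))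
  exact eq_bot_or_eq_top_of_polarization (p := p) m hm (by omega) W (h 0 1 (by decide))
    (h 1 0 (by decide))

theorem isAbsolutelyIrreducible_slForms {m : ℕ} (hm : m ≠ 0) (hmp : m + 1 < p) :
    IsAbsolutelyIrreducible (slForms (ZMod p) m) := by
  intro K _ _
  have : Nontrivial (TensorProduct (ZMod p) K (Forms (ZMod p) m)) :=
    ⟨_, 0, ((formsBasis (ZMod p) m).baseChange K).ne_zero 0⟩
  have hstab : ∀ σ : Subrepresentation
      (((Module.End.baseChangeHom (ZMod p) K (Forms (ZMod p) m) :
        Module.End (ZMod p) (Forms (ZMod p) m) →*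
          Module.End K (TensorProduct (ZMod p) K (Forms (ZMod p) m))).comp
        (slForms (ZMod p) m) : Representation K _ _)), ∀ i j : Fin 2, i ≠ j →
      ∀ w ∈ σ.toSubmodule, (formsPolarization (ZMod p) m i j hm).baseChange K w ∈ σ.toSubmodule := by
    intro σ i j hij w hw
    -- The linear relation has coefficients in the prime field, so it survives every extension of
    -- scalars.
    have : (formsPolarization (ZMod p) m i j hm).baseChange K =
        -∑ t : ZMod p, t ^ (p - 2) •
          (slForms (ZMod p) m (elementarySL hij t)⁻¹).baseChange K := by
      rw [formsPolarization_eq_sum hm hmp hij]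
      change Module.End.baseChangeHom (ZMod p) K (Forms (ZMod p) m) _ = _
      simp only [map_neg, map_sum, map_smul]
      rfl
    rw [this]
    simp only [LinearMap.neg_apply, LinearMap.sum_apply, LinearMap.smul_apply]
    refine neg_mem (sum_mem fun t _ => ?_)
    rw [← algebraMap_smul K]
    exact Submodule.smul_mem _ _ (σ.apply_mem_toSubmodule _ hw)
  have hbt : ∀ σ : Subrepresentation
      (((Module.End.baseChangeHom (ZMod p) K (Forms (ZMod p) m) :
        Module.End (ZMod p) (Forms (ZMod p) m) →*
          Module.End K (TensorProduct (ZMod p) K (Forms (ZMod p) m))).comp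
        (slForms (ZMod p) m) : Representation K _ _)), σ = ⊥ ∨ σ = ⊤ := by
    intro σ
    rcases eq_bot_or_eq_top_of_baseChange_polarization (p := p) m hm (by omega) K σ.toSubmodule
      (hstab σ 0 1 (by decide)) (hstab σ 1 0 (by decide)) with h | h
    · exact Or.inl (Subrepresentation.toSubmodule_injective h)
    · exact Or.inr (Subrepresentation.toSubmodule_injective h)
  exact
    { exists_pair_ne := ⟨⊥, ⊤, fun h => bot_ne_top (α := Submodule K
        (TensorProduct (ZMod p) K (Forms (ZMod p) m))) (congrArg Subrepresentation.toSubmodule h)⟩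
      eq_bot_or_eq_top := hbt }

end Span

/-! ### The group attached to an alternating algebra -/

/-- An abelian group `A` with `A / pA ≃ V ≃ pA`, where the composite is multiplication by `p`,
together with an alternating bilinear product on `V`. -/
structure BracketExtension (p : ℕ) (A V : Type*) [AddCommGroup A] [AddCommGroup V] where
  /-- The reduction modulo `p`. -/
  red : A →+ V
  /-- The isomorphism of `V` with `pA`. -/
  inc : V →+ A
  /-- The alternating product. -/
  bracket : V →+ V →+ V
  red_surjective : Function.Surjective red
  inc_injective : Function.Injective inc
  inc_red : ∀ x, inc (red x) = p • x
  exists_inc_eq : ∀ x, red x = 0 → ∃ v, inc v = x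
  smul_eq_zero : ∀ v : V, p • v = 0
  bracket_self : ∀ v, bracket v v = 0

namespace BracketExtension

variable {p : ℕ} {A V : Type*} [AddCommGroup A] [AddCommGroup V] (D : BracketExtension p A V)

theorem red_inc (v : V) : D.red (D.inc v) = 0 := by
  obtain ⟨x, rfl⟩ := D.red_surjective v
  rw [D.inc_red, map_nsmul, D.smul_eq_zero]

theorem bracket_swap (v w : V) : D.bracket v w = -D.bracket w v := by
  have h := D.bracket_self (v + w)
  simp only [map_add, AddMonoidHom.add_apply, D.bracket_self, zero_add, add_zero] at h
  rw [add_comm] at h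
  exact eq_neg_of_add_eq_zero_left h

/-- The group of class two with underlying set `A` and product `x + y + p[x, y]`. -/
@[ext]
structure Grp (D : BracketExtension p A V) where
  /-- The underlying element of `A`. -/
  val : A

namespace Grp

variable {D}

/-- The class of an element in `V`. -/
def cls (x : D.Grp) : V := D.red x.val

instance : Mul D.Grp := ⟨fun x y => ⟨x.val + y.val + D.inc (D.bracket x.cls y.cls)⟩⟩

instance : One D.Grp := ⟨⟨0⟩⟩

instance : Inv D.Grp := ⟨fun x => ⟨-x.val⟩⟩

theorem val_mul (x y : D.Grp) : (x * y).val = x.val + y.val + D.inc (D.bracket x.cls y.cls) := rfl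

theorem val_one : (1 : D.Grp).val = 0 := rfl

theorem val_inv (x : D.Grp) : x⁻¹.val = -x.val := rfl

@[simp]
theorem cls_mul (x y : D.Grp) : (x * y).cls = x.cls + y.cls := by
  simp only [cls, val_mul, map_add, D.red_inc, add_zero]

@[simp]
theorem cls_inv (x : D.Grp) : x⁻¹.cls = -x.cls := map_neg _ _

@[simp]
theorem cls_one : (1 : D.Grp).cls = 0 := map_zero _

/-- The correction term has class zero, so biadditivity of the bracket suffices for associativity.
-/
instance : Group D.Grp where
  mul_assoc x y z := by
    ext
    simp only [val_mul, cls_mul, map_add, AddMonoidHom.add_apply]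
    abel
  one_mul x := by
    ext
    simp [val_mul, val_one]
  mul_one x := by
    ext
    simp [val_mul, val_one]
  inv_mul_cancel x := by
    ext
    simp [val_mul, val_one, val_inv, D.bracket_self]

/-- The projection onto `V`. -/
def proj (D : BracketExtension p A V) : D.Grp →* Multiplicative V where
  toFun x := Multiplicative.ofAdd x.cls
  map_one' := by rw [cls_one]; rfl
  map_mul' x y := by rw [cls_mul]; rfl

theorem mem_ker_proj {x : D.Grp} : x ∈ (proj D).ker ↔ x.cls = 0 := Iff.rfl

theorem exists_cls_eq (v : V) : ∃ x : D.Grp, x.cls = v :=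
  (D.red_surjective v).elim fun a ha => ⟨⟨a⟩, ha⟩

theorem proj_surjective : Function.Surjective (proj D) := fun v =>
  (exists_cls_eq (D := D) (Multiplicative.toAdd v)).elim fun x hx =>
    ⟨x, congrArg Multiplicative.ofAdd hx⟩

theorem cls_pow (x : D.Grp) (n : ℕ) : (x ^ n).cls = n • x.cls :=
  congrArg Multiplicative.toAdd (map_pow (proj D) x n)

theorem val_pow (x : D.Grp) (n : ℕ) : (x ^ n).val = n • x.val := by
  induction n with
  | zero => simp [val_one]
  | succ n ih =>
    rw [pow_succ, val_mul, ih, cls_pow, map_nsmul, AddMonoidHom.nsmul_apply, D.bracket_self,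
      smul_zero, map_zero, add_zero, succ_nsmul]

/-- The inclusion of `V` as the subgroup of `p`-th powers. -/
def central (D : BracketExtension p A V) (v : V) : D.Grp := ⟨D.inc v⟩

theorem central_injective : Function.Injective (central D) := fun _ _ h =>
  D.inc_injective (congrArg Grp.val h)

theorem central_zero : central D 0 = 1 := Grp.ext (map_zero _)

theorem cls_central (v : V) : (central D v).cls = 0 := D.red_inc v

theorem central_add (v w : V) : central D (v + w) = central D v * central D w := by
  ext
  rw [val_mul, cls_central, map_zero, AddMonoidHom.zero_apply, map_zero, add_zero]
  exact map_add _ _ _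

theorem central_neg (v : V) : central D (-v) = (central D v)⁻¹ := Grp.ext (map_neg _ _)

theorem pow_prime (x : D.Grp) : x ^ p = central D x.cls :=
  Grp.ext <| by rw [val_pow]; exact (D.inc_red _).symm

theorem exists_central_eq {x : D.Grp} (hx : x.cls = 0) : ∃ v, central D v = x :=
  (D.exists_inc_eq _ hx).elim fun v hv => ⟨v, Grp.ext hv⟩

/-- The commutator is twice the bracket; recovering the bracket from it will require `p` odd. -/
theorem mul_eq_central_mul (x y : D.Grp) :
    x * y = central D (D.bracket x.cls y.cls + D.bracket x.cls y.cls) * (y * x) := by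
  ext
  simp only [val_mul, cls_central, map_zero, AddMonoidHom.zero_apply, add_zero]
  simp only [central, map_add, D.bracket_swap y.cls x.cls, map_neg]
  abel

/-- Central elements are `p`-th powers, so an automorphism acts on `pA` as it acts on the quotient
`V`. -/
theorem map_central {α : D.Grp ≃* D.Grp} {g : V → V} (hα : ∀ x, (α x).cls = g x.cls) (v : V) :
    α (central D v) = central D (g v) := by
  obtain ⟨x, rfl⟩ := exists_cls_eq (D := D) v
  rw [← pow_prime, map_pow, pow_prime, hα]

instance [Finite A] : Finite D.Grp :=
  Finite.of_injective Grp.val fun _ _ => Grp.ext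

/-- An additive endomorphism of `A` that induces an injective endomorphism of the algebra `V` is
an automorphism of the group. -/
theorem exists_mulEquiv [Finite A] (α : A →+ A) (g : V →+ V) (hg : Function.Injective g)
    (hα : ∀ x, D.red (α x) = g (D.red x))
    (hB : ∀ v w, D.bracket (g v) (g w) = g (D.bracket v w)) :
    ∃ β : D.Grp ≃* D.Grp, ∀ x, (β x).cls = g x.cls := by
  have hinc : ∀ v, α (D.inc v) = D.inc (g v) := by
    intro v
    obtain ⟨x, rfl⟩ := D.red_surjective v
    rw [D.inc_red, map_nsmul, ← D.inc_red, hα]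
  let f : D.Grp →* D.Grp := MonoidHom.mk' (fun x => ⟨α x.val⟩) fun x y => by
    ext
    simp only [val_mul, map_add, hinc, cls, hα, hB]
  have hinj : Function.Injective f := by
    rw [injective_iff_map_eq_one]
    intro x hx
    have hx' : α x.val = 0 := congrArg Grp.val hx
    have h0 : x.cls = 0 := hg (by rw [map_zero, cls, ← hα, hx', map_zero])
    obtain ⟨v, rfl⟩ := exists_central_eq h0
    have : D.inc (g v) = D.inc (g 0) := by rw [← hinc, map_zero, map_zero]; exact hx'
    rw [hg (D.inc_injective this), central_zero]
  exact ⟨MulEquiv.ofBijective f ⟨hinj, Finite.injective_iff_surjective.mp hinj⟩,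
    fun x => hα x.val⟩

/-- Otherwise `M` and the kernel generate the group. Every kernel element is some `y ^ p` with `y =
a * z`, `a ∈ M` and `z` in the kernel; as `y ^ p` depends only on the class of `y`, it equals `a ^ p
∈ M`. -/
theorem ker_proj_le_of_isCoatom {M : Subgroup D.Grp} (hM : IsCoatom M) : (proj D).ker ≤ M := by
  by_contra h
  have hsup : M ⊔ (proj D).ker = ⊤ := hM.2 _ (left_lt_sup.mpr h)
  refine h fun x hx => ?_
  obtain ⟨v, rfl⟩ := exists_central_eq (mem_ker_proj.mp hx)
  obtain ⟨y, rfl⟩ := exists_cls_eq (D := D) v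
  have hy : y ∈ M ⊔ (proj D).ker := hsup ▸ Subgroup.mem_top y
  rw [← SetLike.mem_coe, Subgroup.mul_normal] at hy
  obtain ⟨a, ha, z, hz, rfl⟩ := hy
  rw [cls_mul, mem_ker_proj.mp hz, add_zero, ← pow_prime]
  exact M.pow_mem ha p

theorem ker_proj_le_frattini : (proj D).ker ≤ frattini D.Grp :=
  le_iInf₂ fun _ hM => ker_proj_le_of_isCoatom hM

theorem isPGroup : IsPGroup p D.Grp := fun x =>
  ⟨2, by rw [sq, pow_mul, pow_prime, pow_prime, cls_central, central_zero]⟩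

theorem exponent_eq [hp : Fact p.Prime] [Nontrivial V] : Monoid.exponent D.Grp = p ^ 2 := by
  have h2 : Monoid.exponent D.Grp ∣ p ^ 2 := Monoid.exponent_dvd_of_forall_pow_eq_one fun x => by
    rw [sq, pow_mul, pow_prime, pow_prime, cls_central, central_zero]
  obtain ⟨i, hi, he⟩ := (Nat.dvd_prime_pow hp.out).mp h2
  rcases hi.lt_or_eq with hi | rfl
  · exfalso
    obtain ⟨v, hv⟩ := exists_ne (0 : V)
    obtain ⟨x, rfl⟩ := exists_cls_eq (D := D) v
    have h1 : Monoid.exponent D.Grp ∣ p := by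
      rw [he]
      exact (pow_dvd_pow p (Nat.le_of_lt_succ hi)).trans (by rw [pow_one])
    have := Monoid.exponent_dvd_iff_forall_pow_eq_one.mp h1 x
    rw [pow_prime, ← central_zero] at this
    exact hv (central_injective this)
  · exact he

/-! ### Characteristic subgroups, Frattini quotient and rank -/

section Irreducible

variable {Γ : Type*} (ρ : Γ → V → V) (hρ : ∀ γ, ∃ α : D.Grp ≃* D.Grp, ∀ x, (α x).cls = ρ γ x.cls)
  (hirr : ∀ U : AddSubgroup V, (∀ γ, ∀ u ∈ U, ρ γ u ∈ U) → U = ⊥ ∨ U = ⊤)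

include hρ hirr

theorem eq_top_of_characteristic [Finite A] {N : Subgroup D.Grp} [hN : N.Characteristic]
    (h : ¬ N ≤ (proj D).ker) : N = ⊤ := by
  have hU : (Subgroup.toAddSubgroup' (N.map (proj D))) = ⊤ := by
    refine (hirr _ ?_).resolve_left ?_
    · rintro γ _ ⟨x, hx, rfl⟩
      obtain ⟨α, hα⟩ := hρ γ
      exact ⟨α x, (Subgroup.characteristic_iff_map_le.mp hN α) ⟨x, hx, rfl⟩, hα x⟩
    · intro hbot
      refine h fun x hx => ?_
      have : x.cls ∈ (Subgroup.toAddSubgroup' (N.map (proj D))) := ⟨x, hx, rfl⟩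
      rw [hbot] at this
      exact this
  apply frattini_nongenerating
  rw [eq_top_iff]
  intro x _
  have hx : x.cls ∈ (Subgroup.toAddSubgroup' (N.map (proj D))) := hU ▸ AddSubgroup.mem_top _
  obtain ⟨y, hy, hyx⟩ := hx
  have hyx' : y.cls = x.cls := hyx
  have hz : y⁻¹ * x ∈ frattini D.Grp := ker_proj_le_frattini (mem_ker_proj.mpr (by simp [hyx']))
  rw [← mul_inv_cancel_left y x]
  exact Subgroup.mul_mem_sup hy hz

theorem frattini_eq_ker_proj [Finite A] [Nontrivial V] : frattini D.Grp = (proj D).ker := by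
  refine le_antisymm ?_ ker_proj_le_frattini
  by_contra h
  have htop := eq_top_of_characteristic ρ hρ hirr h
  have hbot : (⊥ : Subgroup D.Grp) = ⊤ := frattini_nongenerating (by rw [htop, bot_sup_eq])
  obtain ⟨v, hv⟩ := exists_ne (0 : V)
  have : central D v ∈ (⊥ : Subgroup D.Grp) := hbot ▸ Subgroup.mem_top _
  rw [Subgroup.mem_bot, ← central_zero] at this
  exact hv (central_injective this)

theorem isUCS [Finite A] [Nontrivial V] : IsUCS D.Grp := by
  obtain ⟨v, hv⟩ := exists_ne (0 : V)
  refine ⟨(proj D).ker, ⟨?_, ?_, ?_⟩, ?_⟩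
  · rw [← frattini_eq_ker_proj ρ hρ hirr]
    infer_instance
  · intro h
    have : central D v ∈ (proj D).ker := cls_central v
    rw [h, Subgroup.mem_bot, ← central_zero] at this
    exact hv (central_injective this)
  · intro h
    obtain ⟨x, rfl⟩ := exists_cls_eq (D := D) v
    exact hv (mem_ker_proj.mp (h ▸ Subgroup.mem_top x))
  · rintro N ⟨hN, hbot, htop⟩
    have hle : N ≤ (proj D).ker := by
      by_contra h
      exact htop (eq_top_of_characteristic ρ hρ hirr h)
    -- Transport `N` to `V` along the power map; `map_central` makes it invariant under the same
    -- operators `ρ`.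
    let U : AddSubgroup V :=
      { carrier := {v | central D v ∈ N}
        zero_mem' := by
          change central D 0 ∈ N
          rw [central_zero]
          exact N.one_mem
        add_mem' := fun {a b} ha hb => by
          change central D (a + b) ∈ N
          rw [central_add]
          exact N.mul_mem ha hb
        neg_mem' := fun {a} ha => by
          change central D (-a) ∈ N
          rw [central_neg]
          exact N.inv_mem ha }
    have hU : U = ⊥ ∨ U = ⊤ := by
      refine hirr U fun γ u hu => ?_
      obtain ⟨α, hα⟩ := hρ γ
      change central D (ρ γ u) ∈ N
      rw [← map_central hα]
      exact (Subgroup.characteristic_iff_map_le.mp hN α) ⟨_, hu, rfl⟩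
    rcases hU with hU | hU
    · refine absurd ((Subgroup.eq_bot_iff_forall _).mpr fun x hx => ?_) hbot
      obtain ⟨w, rfl⟩ := exists_central_eq (mem_ker_proj.mp (hle hx))
      have : w ∈ U := hx
      rw [hU, AddSubgroup.mem_bot] at this
      rw [this, central_zero]
    · refine le_antisymm hle fun x hx => ?_
      obtain ⟨w, rfl⟩ := exists_central_eq (mem_ker_proj.mp hx)
      have : w ∈ U := hU ▸ AddSubgroup.mem_top w
      exact this

/-- The isomorphism of `V` with the Frattini quotient. -/
theorem exists_frattiniQuotient_equiv [Finite A] [Nontrivial V] :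
    ∃ e : Multiplicative V ≃* D.Grp ⧸ frattini D.Grp,
      ∀ x : D.Grp, e (Multiplicative.ofAdd x.cls) = (x : D.Grp ⧸ frattini D.Grp) := by
  refine ⟨(QuotientGroup.quotientKerEquivOfSurjective (proj D) proj_surjective).symm.trans
    (QuotientGroup.quotientMulEquivOfEq (frattini_eq_ker_proj ρ hρ hirr).symm), fun x => ?_⟩
  have : (QuotientGroup.quotientKerEquivOfSurjective (proj D) proj_surjective).symm
      (Multiplicative.ofAdd x.cls) = (x : D.Grp ⧸ (proj D).ker) := by
    rw [MulEquiv.symm_apply_eq]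
    rfl
  rw [MulEquiv.trans_apply, this]
  rfl

end Irreducible

theorem rank_eq [Finite A] [Fact p.Prime] [Module (ZMod p) V] {n : ℕ}
    (b : Module.Basis (Fin n) (ZMod p) V) : Group.rank D.Grp = n := by
  classical
  apply le_antisymm
  · choose x hx using fun i => exists_cls_eq (D := D) (b i)
    have hS : Subgroup.closure ((Finset.univ.image x : Finset D.Grp) : Set D.Grp) = ⊤ := by
      apply frattini_nongenerating
      set K := Subgroup.closure ((Finset.univ.image x : Finset D.Grp) : Set D.Grp) with hK
      have hU : AddSubgroup.toZModSubmodule p (Subgroup.toAddSubgroup' (K.map (proj D))) = ⊤ := by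
        rw [eq_top_iff, ← b.span_eq, Submodule.span_le]
        rintro _ ⟨i, rfl⟩
        exact ⟨x i, Subgroup.subset_closure (by simp), hx i⟩
      rw [eq_top_iff]
      intro y _
      have hy : y.cls ∈ AddSubgroup.toZModSubmodule p
        (Subgroup.toAddSubgroup' (K.map (proj D))) := hU ▸ Submodule.mem_top
      obtain ⟨z, hz, hzy⟩ := hy
      have hzy' : z.cls = y.cls := hzy
      have hf : z⁻¹ * y ∈ frattini D.Grp :=
        ker_proj_le_frattini (mem_ker_proj.mpr (by simp [hzy']))
      rw [← mul_inv_cancel_left z y]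
      exact Subgroup.mul_mem_sup hz hf
    refine (Group.rank_le hS).trans (Finset.card_image_le.trans ?_)
    simp
  · obtain ⟨S, hcard, hS⟩ := Group.rank_spec D.Grp
    have hspan : Submodule.span (ZMod p) ((S.image cls : Finset V) : Set V) = ⊤ := by
      rw [eq_top_iff]
      intro v _
      obtain ⟨x, rfl⟩ := exists_cls_eq (D := D) v
      have hx : x ∈ Subgroup.closure (S : Set D.Grp) := hS ▸ Subgroup.mem_top x
      induction hx using Subgroup.closure_induction with
      | mem x hx => exact Submodule.subset_span (by simpa using ⟨x, hx, rfl⟩)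
      | one => rw [cls_one]; exact Submodule.zero_mem _
      | mul x y _ _ hx hy => rw [cls_mul]; exact Submodule.add_mem _ (hx trivial) (hy trivial)
      | inv x _ hx => rw [cls_inv]; exact Submodule.neg_mem _ (hx trivial)
    have := finrank_span_finset_le_card (R := ZMod p) (S.image (cls (D := D)))
    rw [Set.finrank, hspan, finrank_top, Module.finrank_eq_card_basis b, Fintype.card_fin] at this
    exact this.trans (Finset.card_image_le.trans hcard.le)

/-! ### Direct factors of the group give ideals of the algebra -/

theorem mem_of_add_self_mem (D : BracketExtension p A V) (hp : Odd p) {U : AddSubgroup V} {v : V}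
    (h : v + v ∈ U) : v ∈ U := by
  obtain ⟨k, hk⟩ := hp
  -- For `p = 2k + 1`, the inverse of `2` modulo `p` is `k + 1`.
  have h1 : (k + 1) • (v + v) = v := by
    have := D.smul_eq_zero v
    rw [hk] at this
    rw [← two_nsmul, ← mul_nsmul, show 2 * (k + 1) = 2 * k + 1 + 1 by ring, succ_nsmul, this,
      zero_add]
  rw [← h1]
  exact U.nsmul_mem h _

/-- The image of a subgroup in `V`. -/
def image (K : Subgroup D.Grp) : AddSubgroup V := Subgroup.toAddSubgroup' (K.map (proj D))

theorem mem_image {K : Subgroup D.Grp} {v : V} : v ∈ image K ↔ ∃ x ∈ K, x.cls = v := Iff.rfl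

section Factors

variable {K₁ K₂ : Subgroup D.Grp} (hcomm : ∀ x ∈ K₁, ∀ y ∈ K₂, x * y = y * x)
  (hdisj : ∀ x ∈ K₁, x ∈ K₂ → x = 1) (hgen : ∀ x, ∃ a ∈ K₁, ∃ b ∈ K₂, x = a * b)

include hcomm in
theorem bracket_eq_zero_of_commute (hp : Odd p) : ∀ v ∈ image K₁, ∀ w ∈ image K₂,
    D.bracket v w = 0 := by
  rintro _ ⟨x, hx, rfl⟩ _ ⟨y, hy, rfl⟩
  have h := mul_eq_central_mul x y
  rw [hcomm x hx y hy, right_eq_mul, ← central_zero] at h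
  refine AddSubgroup.mem_bot.mp (mem_of_add_self_mem D hp ?_)
  exact AddSubgroup.mem_bot.mpr (central_injective h)

include hdisj in
theorem cls_eq_zero_of_pow_mem {x : D.Grp} (h₁ : x ^ p ∈ K₁) (h₂ : x ^ p ∈ K₂) : x.cls = 0 := by
  have h := hdisj _ h₁ h₂
  rw [pow_prime, ← central_zero] at h
  exact central_injective h

-- Elements of `K₁` and `K₂` with equal class have equal `p`-th powers, which lie in both subgroups
-- and so are trivial.
include hdisj in
theorem image_inf_image : image K₁ ⊓ image K₂ = ⊥ := by
  rw [eq_bot_iff]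
  rintro _ ⟨⟨x, hx, rfl⟩, ⟨y, hy, hyx⟩⟩
  refine cls_eq_zero_of_pow_mem hdisj (K₁.pow_mem hx p) ?_
  have hyx' : y.cls = x.cls := hyx
  rw [pow_prime, ← hyx', ← pow_prime]
  exact K₂.pow_mem hy p

include hgen in
theorem image_sup_image : image K₁ ⊔ image K₂ = ⊤ := by
  rw [eq_top_iff]
  intro v _
  obtain ⟨x, rfl⟩ := exists_cls_eq (D := D) v
  obtain ⟨a, ha, b, hb, rfl⟩ := hgen x
  rw [cls_mul]
  exact AddSubgroup.add_mem_sup ⟨a, ha, rfl⟩ ⟨b, hb, rfl⟩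

include hcomm hdisj hgen

/-- Write the class `2[x, y]` as that of `a * b`. The commutator of `x` and `y` is then `a ^ p * b ^
p`; it lies in `K₁`, so `b ^ p` lies in both factors and `b` has class zero. -/
theorem bracket_mem_image (hp : Odd p) : ∀ v ∈ image K₁, ∀ w ∈ image K₁,
    D.bracket v w ∈ image K₁ := by
  rintro _ ⟨x, hx, rfl⟩ _ ⟨y, hy, rfl⟩
  change D.bracket x.cls y.cls ∈ _
  refine mem_of_add_self_mem D hp ?_
  obtain ⟨z, hz⟩ := exists_cls_eq (D := D) (D.bracket x.cls y.cls + D.bracket x.cls y.cls)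
  obtain ⟨a, ha, b, hb, rfl⟩ := hgen z
  have h := mul_eq_central_mul x y
  rw [← hz, ← pow_prime, (show Commute a b from hcomm a ha b hb).mul_pow] at h
  have hbp : b ^ p = (a ^ p)⁻¹ * (x * y * (y * x)⁻¹) := by
    rw [h]
    group
  have hb0 : b.cls = 0 := by
    refine cls_eq_zero_of_pow_mem hdisj ?_ (K₂.pow_mem hb p)
    rw [hbp]
    exact K₁.mul_mem (K₁.inv_mem (K₁.pow_mem ha p))
      (K₁.mul_mem (K₁.mul_mem hx hy) (K₁.inv_mem (K₁.mul_mem hy hx)))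
  rw [← hz, cls_mul, hb0, add_zero]
  exact ⟨a, ha, rfl⟩

-- An element of `K₁` is now central, hence a power `(a * b) ^ p`; since `a` has class zero this is
-- `b ^ p ∈ K₂`.
omit hcomm in
theorem eq_bot_of_image_eq_bot (h : image K₁ = ⊥) : K₁ = ⊥ := by
  have h0 : ∀ x ∈ K₁, x.cls = 0 := fun x hx =>
    AddSubgroup.mem_bot.mp (h ▸ mem_image.mpr ⟨x, hx, rfl⟩)
  rw [Subgroup.eq_bot_iff_forall]
  intro x hx
  obtain ⟨v, rfl⟩ := exists_central_eq (h0 x hx)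
  obtain ⟨z, rfl⟩ := exists_cls_eq (D := D) v
  obtain ⟨a, ha, b, hb, rfl⟩ := hgen z
  refine hdisj _ hx ?_
  rw [cls_mul, h0 a ha, zero_add, ← pow_prime]
  exact K₂.pow_mem hb p

end Factors

/-- If `V` is not a direct sum of two non-zero ideals, then the group is not a direct product of
two non-trivial groups. -/
theorem subsingleton_of_mulEquiv_prod (hp : Odd p)
    (hV : ∀ W₁ W₂ : AddSubgroup V, W₁ ⊔ W₂ = ⊤ → W₁ ⊓ W₂ = ⊥ →
      (∀ x ∈ W₁, ∀ y ∈ W₂, D.bracket x y = 0) → (∀ x ∈ W₁, ∀ y ∈ W₁, D.bracket x y ∈ W₁) →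
      (∀ x ∈ W₂, ∀ y ∈ W₂, D.bracket x y ∈ W₂) → W₁ = ⊥ ∨ W₂ = ⊥)
    {H₁ H₂ : Type*} [Group H₁] [Group H₂] (φ : D.Grp ≃* H₁ × H₂) :
    Subsingleton H₁ ∨ Subsingleton H₂ := by
  let i₁ : H₁ →* D.Grp := φ.symm.toMonoidHom.comp (MonoidHom.inl H₁ H₂)
  let i₂ : H₂ →* D.Grp := φ.symm.toMonoidHom.comp (MonoidHom.inr H₁ H₂)
  have hi₁ : Function.Injective i₁ := φ.symm.injective.comp fun _ _ h => congrArg Prod.fst h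
  have hi₂ : Function.Injective i₂ := φ.symm.injective.comp fun _ _ h => congrArg Prod.snd h
  have hcomm : ∀ x ∈ i₁.range, ∀ y ∈ i₂.range, x * y = y * x := by
    rintro _ ⟨a, rfl⟩ _ ⟨b, rfl⟩
    change φ.symm (a, 1) * φ.symm (1, b) = φ.symm (1, b) * φ.symm (a, 1)
    simp [← map_mul]
  have hdisj : ∀ x ∈ i₁.range, x ∈ i₂.range → x = 1 := by
    rintro _ ⟨a, rfl⟩ ⟨b, hb⟩
    have h : ((1, b) : H₁ × H₂) = (a, 1) := φ.symm.injective hb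
    have ha : a = 1 := (congrArg Prod.fst h).symm
    rw [ha, map_one]
  have hgen : ∀ x, ∃ a ∈ i₁.range, ∃ b ∈ i₂.range, x = a * b := fun x =>
    ⟨_, ⟨(φ x).1, rfl⟩, _, ⟨(φ x).2, rfl⟩, by
      change x = φ.symm ((φ x).1, 1) * φ.symm (1, (φ x).2)
      simp [← map_mul]⟩
  have hcomm' : ∀ x ∈ i₂.range, ∀ y ∈ i₁.range, x * y = y * x := fun x hx y hy =>
    (hcomm y hy x hx).symm
  have hdisj' : ∀ x ∈ i₂.range, x ∈ i₁.range → x = 1 := fun x h₂ h₁ => hdisj x h₁ h₂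
  have hgen' : ∀ x, ∃ a ∈ i₂.range, ∃ b ∈ i₁.range, x = a * b := fun x => by
    obtain ⟨a, ha, b, hb, rfl⟩ := hgen x
    exact ⟨b, hb, a, ha, hcomm a ha b hb⟩
  refine (hV _ _ (image_sup_image hgen) (image_inf_image hdisj)
    (bracket_eq_zero_of_commute hcomm hp) (bracket_mem_image hcomm hdisj hgen hp)
    (bracket_mem_image hcomm' hdisj' hgen' hp)).imp (fun h => ?_) fun h => ?_
  · have := eq_bot_of_image_eq_bot hdisj hgen h
    rw [MonoidHom.range_eq_bot_iff] at this
    exact ⟨fun a b => hi₁ (by rw [this]; rfl)⟩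
  · have := eq_bot_of_image_eq_bot hdisj' hgen' h
    rw [MonoidHom.range_eq_bot_iff] at this
    exact ⟨fun a b => hi₂ (by rw [this]; rfl)⟩

end Grp

end BracketExtension

/-! ### The homocyclic group of exponent `p²` -/

section PrimeSquare

variable (p : ℕ)

/-- The reduction `ℤ / p² → ℤ / p`. -/
def ZMod.redSq : ZMod (p ^ 2) →+* ZMod p := ZMod.castHom (dvd_pow_self p two_ne_zero) (ZMod p)

/-- Multiplication by `p`, as an embedding of `ℤ / p` into `ℤ / p²`. -/
def ZMod.incSq : ZMod p →+ ZMod (p ^ 2) :=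
  ZMod.lift p ⟨(AddMonoidHom.mulLeft (p : ZMod (p ^ 2))).comp (Int.castAddHom _), by
    simp [← sq, ← Nat.cast_pow]⟩

theorem ZMod.incSq_intCast (n : ℤ) : ZMod.incSq p n = p * n := ZMod.lift_coe _ _ _

theorem ZMod.incSq_redSq (x : ZMod (p ^ 2)) : ZMod.incSq p (ZMod.redSq p x) = p • x := by
  obtain ⟨n, rfl⟩ := ZMod.intCast_surjective x
  rw [map_intCast, ZMod.incSq_intCast, nsmul_eq_mul]

theorem ZMod.redSq_surjective : Function.Surjective (ZMod.redSq p) :=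
  ZMod.castHom_surjective _

theorem ZMod.incSq_injective [Fact p.Prime] : Function.Injective (ZMod.incSq p) := by
  have hp : (p : ℤ) ≠ 0 := by exact_mod_cast (Fact.out : p.Prime).ne_zero
  rw [injective_iff_map_eq_zero]
  intro x hx
  obtain ⟨n, rfl⟩ := ZMod.intCast_surjective x
  rw [ZMod.incSq_intCast, ← Int.cast_natCast p, ← Int.cast_mul, ZMod.intCast_zmod_eq_zero_iff_dvd] at hx
  rw [ZMod.intCast_zmod_eq_zero_iff_dvd]
  rw [Nat.cast_pow, sq] at hx
  exact (mul_dvd_mul_iff_left hp).mp hx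

theorem ZMod.exists_incSq_eq (x : ZMod (p ^ 2)) (hx : ZMod.redSq p x = 0) :
    ∃ y, ZMod.incSq p y = x := by
  obtain ⟨n, rfl⟩ := ZMod.intCast_surjective x
  rw [map_intCast, ZMod.intCast_zmod_eq_zero_iff_dvd] at hx
  obtain ⟨k, rfl⟩ := hx
  exact ⟨k, by rw [ZMod.incSq_intCast]; push_cast; rfl⟩

end PrimeSquare

section Homocyclic

variable {p n : ℕ} [Fact p.Prime] {V : Type*} [AddCommGroup V] [Module (ZMod p) V]

/-- The extension of an alternating algebra over the field of `p` elements by the homocyclic group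
of exponent `p²`. -/
noncomputable def homocyclicExtension (b : Module.Basis (Fin n) (ZMod p) V)
    (B : V →+ V →+ V) (hB : ∀ v, B v v = 0) :
    BracketExtension p (Fin n → ZMod (p ^ 2)) V where
  red := b.equivFun.symm.toLinearMap.toAddMonoidHom.comp
    ((ZMod.redSq p).toAddMonoidHom.compLeft (Fin n))
  inc := ((ZMod.incSq p).compLeft (Fin n)).comp b.equivFun.toLinearMap.toAddMonoidHom
  bracket := B
  red_surjective := b.equivFun.symm.surjective.comp (ZMod.redSq_surjective p).comp_left
  inc_injective := (ZMod.incSq_injective p).comp_left.comp b.equivFun.injective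
  inc_red x := by
    ext i
    have h := congr_fun (b.equivFun.apply_symm_apply (ZMod.redSq p ∘ x)) i
    exact (congrArg (ZMod.incSq p) h).trans (ZMod.incSq_redSq p (x i))
  exists_inc_eq x hx := by
    have hx' : ∀ i, ZMod.redSq p (x i) = 0 := congr_fun (b.equivFun.symm.map_eq_zero_iff.mp hx)
    choose y hy using fun i => ZMod.exists_incSq_eq p (x i) (hx' i)
    refine ⟨b.equivFun.symm y, ?_⟩
    ext i
    exact (congrArg (ZMod.incSq p) (congr_fun (b.equivFun.apply_symm_apply y) i)).trans (hy i)
  smul_eq_zero v := by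
    rw [← Nat.cast_smul_eq_nsmul (ZMod p), CharP.cast_eq_zero, zero_smul]
  bracket_self := hB

/-- The matrix of `g` is lifted entry by entry; the lifts need not be multiplicative in `g`. -/
theorem exists_lift_homocyclic (b : Module.Basis (Fin n) (ZMod p) V)
    (B : V →+ V →+ V) (hB : ∀ v, B v v = 0) (g : V →ₗ[ZMod p] V) :
    ∃ α : (Fin n → ZMod (p ^ 2)) →+ (Fin n → ZMod (p ^ 2)),
      ∀ x, (homocyclicExtension b B hB).red (α x) = g ((homocyclicExtension b B hB).red x) := by
  choose c hc using ZMod.redSq_surjective p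
  let M : Matrix (Fin n) (Fin n) (ZMod (p ^ 2)) := (LinearMap.toMatrix b b g).map c
  have hM : M.map (ZMod.redSq p) = LinearMap.toMatrix b b g := by
    ext i j
    exact hc _
  refine ⟨M.mulVecLin.toAddMonoidHom, fun x => ?_⟩
  apply b.equivFun.injective
  have h1 : b.equivFun ((homocyclicExtension b B hB).red (M.mulVecLin x)) =
      ZMod.redSq p ∘ (M.mulVec x) := b.equivFun.apply_symm_apply _
  have h2 : b.equivFun ((homocyclicExtension b B hB).red x) = ZMod.redSq p ∘ x :=
    b.equivFun.apply_symm_apply _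
  refine h1.trans ?_
  have h3 := LinearMap.toMatrix_mulVec_repr b b g ((homocyclicExtension b B hB).red x)
  rw [← hM] at h3
  refine Eq.trans ?_ h3
  ext i
  rw [Function.comp_apply, RingHom.map_mulVec]
  exact congr_fun (congrArg _ h2.symm) i

end Homocyclic

/-! ### The transvectant algebra: centre and ideals -/

section FormsBracket

variable {F : Type*} [Field F]

/-- The transvectant of order `m / 2`, as a product on `V_m`. -/
noncomputable def formsBracket (F : Type*) [Field F] (k : ℕ) :
    Forms F (2 * k) →ₗ[F] Forms F (2 * k) →ₗ[F] Forms F (2 * k) :=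
  LinearMap.mk₂ F
    (fun f g => ⟨transvectant F k f g, by
      have := isHomogeneous_transvectant k (show IsHomogeneous f.1 (2 * k) from f.2)
        (show IsHomogeneous g.1 (2 * k) from g.2)
      rwa [show 2 * k - k + (2 * k - k) = 2 * k by omega] at this⟩)
    (fun f₁ f₂ g => Subtype.ext (by simp))
    (fun c f g => Subtype.ext (by simp))
    (fun f g₁ g₂ => Subtype.ext (by simp))
    (fun c f g => Subtype.ext (by simp))

theorem coe_formsBracket (k : ℕ) (f g : Forms F (2 * k)) :
    (formsBracket F k f g : MvPolynomial (Fin 2) F) = transvectant F k f g := rfl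

theorem formsBracket_swap {k : ℕ} (hk : Odd k) (f g : Forms F (2 * k)) :
    formsBracket F k g f = -formsBracket F k f g := by
  ext1
  simp only [coe_formsBracket, Submodule.coe_neg]
  rw [transvectant_swap, hk.neg_one_pow, neg_one_mul]

theorem formsBracket_self {k : ℕ} (hk : Odd k) (h2 : (2 : F) ≠ 0) (f : Forms F (2 * k)) :
    formsBracket F k f f = 0 := by
  have h := eq_neg_iff_add_eq_zero.mp (formsBracket_swap hk f f)
  rw [← two_smul F] at h
  exact (smul_eq_zero.mp h).resolve_left h2

theorem formsBracket_slForms (k : ℕ) (A : Matrix.SpecialLinearGroup (Fin 2) F)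
    (f g : Forms F (2 * k)) :
    formsBracket F k (slForms F (2 * k) A f) (slForms F (2 * k) A g) =
      slForms F (2 * k) A (formsBracket F k f g) := by
  ext1
  refine (transvectant_matSubst _ k f.1 g.1).trans ?_
  rw [Matrix.SpecialLinearGroup.det_coe, one_pow, one_smul]
  rfl

theorem formsPolarization_formsBracket {k : ℕ} (hk : 2 * k ≠ 0) {i j : Fin 2} (hij : i ≠ j)
    (f g : Forms F (2 * k)) :
    formsPolarization F (2 * k) i j hk (formsBracket F k f g) =
      formsBracket F k (formsPolarization F (2 * k) i j hk f) g +
        formsBracket F k f (formsPolarization F (2 * k) i j hk g) :=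
  Subtype.ext (polarization_transvectant hij k f.1 g.1)

theorem formsBracket_ne_zero {p : ℕ} (hp : p.Prime) [CharP F p] {k : ℕ} (hk : 2 * k < p) :
    ∃ f g, formsBracket F k f g ≠ 0 := by
  refine ⟨⟨X 0 ^ (2 * k), by simpa using isHomogeneous_X_pow (R := F) (0 : Fin 2) (2 * k)⟩,
    ⟨X 1 ^ (2 * k), by simpa using isHomogeneous_X_pow (R := F) (1 : Fin 2) (2 * k)⟩, fun h => ?_⟩
  exact transvectant_ne_zero (F := F) hp hk (k := k) (by omega) (congrArg Subtype.val h)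

/-- The algebra `V_m` has no centre. -/
theorem eq_zero_of_formsBracket_eq_zero {p : ℕ} (hp : p.Prime) [CharP F p] {k : ℕ} (hk0 : k ≠ 0)
    (hk : 2 * k < p) {f : Forms F (2 * k)} (hf : ∀ g, formsBracket F k f g = 0) : f = 0 := by
  have hm : 2 * k ≠ 0 := by omega
  -- The annihilator of an algebra is stable under its derivations.
  have hstab : ∀ i j : Fin 2, i ≠ j → ∀ w ∈ LinearMap.ker (formsBracket F k),
      formsPolarization F (2 * k) i j hm w ∈ LinearMap.ker (formsBracket F k) := by
    intro i j hij w hw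
    rw [LinearMap.mem_ker] at hw ⊢
    ext1 g
    have h := formsPolarization_formsBracket hm hij w g
    simp only [hw, LinearMap.zero_apply, map_zero, add_zero] at h
    rw [← h, LinearMap.zero_apply]
  rcases eq_bot_or_eq_top_of_polarization (p := p) (2 * k) hm hk _ (hstab 0 1 (by decide))
    (hstab 1 0 (by decide)) with h | h
  · exact (LinearMap.ker_eq_bot'.mp h) f (LinearMap.ext hf)
  · obtain ⟨f', g', hfg⟩ := formsBracket_ne_zero (F := F) hp hk
    have : f' ∈ LinearMap.ker (formsBracket F k) := h ▸ Submodule.mem_top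
    rw [LinearMap.mem_ker] at this
    rw [this] at hfg
    exact absurd rfl hfg

/-- The algebra `V_m` is not a direct sum of two non-zero ideals. -/
theorem eq_bot_or_eq_bot_of_ideals {p : ℕ} (hp : p.Prime) [CharP F p] {k : ℕ} (hkodd : Odd k)
    (hk : 2 * k < p) {W₁ W₂ : Submodule F (Forms F (2 * k))} (hsup : W₁ ⊔ W₂ = ⊤)
    (hinf : W₁ ⊓ W₂ = ⊥) (h₁₂ : ∀ x ∈ W₁, ∀ y ∈ W₂, formsBracket F k x y = 0)
    (h₁ : ∀ x ∈ W₁, ∀ y ∈ W₁, formsBracket F k x y ∈ W₁)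
    (h₂ : ∀ x ∈ W₂, ∀ y ∈ W₂, formsBracket F k x y ∈ W₂) : W₁ = ⊥ ∨ W₂ = ⊥ := by
  have hk0 : k ≠ 0 := hkodd.pos.ne'
  have hm : 2 * k ≠ 0 := by omega
  have hdec : ∀ v, ∃ a ∈ W₁, ∃ b ∈ W₂, a + b = v := fun v =>
    Submodule.mem_sup.mp (hsup ▸ Submodule.mem_top)
  have hstab : ∀ i j : Fin 2, i ≠ j → ∀ w ∈ W₁, formsPolarization F (2 * k) i j hm w ∈ W₁ := by
    intro i j hij x hx
    obtain ⟨a, ha, b, hb, hab⟩ := hdec (formsPolarization F (2 * k) i j hm x)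
    -- The stray component `b` is central: it kills `W₁`, and for `y ∈ W₂` applying the derivation
    -- to `[x, y] = 0` gives `[b, y] = -[x, c]`, with `c` the `W₁`-part of the image of `y`. This
    -- lies in `W₁ ⊓ W₂ = ⊥`.
    have hb0 : b = 0 := by
      refine eq_zero_of_formsBracket_eq_zero hp hk0 hk fun g => ?_
      obtain ⟨y₁, hy₁, y, hy, rfl⟩ := hdec g
      rw [map_add, formsBracket_swap hkodd y₁ b, h₁₂ y₁ hy₁ b hb, neg_zero, zero_add]
      obtain ⟨c, hc, d, hd, hcd⟩ := hdec (formsPolarization F (2 * k) i j hm y)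
      have h := formsPolarization_formsBracket hm hij x y
      rw [h₁₂ x hx y hy, map_zero, ← hab, ← hcd, map_add, LinearMap.add_apply, h₁₂ a ha y hy,
        map_add, h₁₂ x hx d hd, zero_add, add_zero] at h
      have hmem : formsBracket F k b y ∈ W₁ ⊓ W₂ := by
        refine ⟨?_, h₂ b hb y hy⟩
        rw [eq_neg_of_add_eq_zero_left h.symm]
        exact W₁.neg_mem (h₁ x hx c hc)
      rw [hinf] at hmem
      exact hmem
    rw [← hab, hb0, add_zero]
    exact ha
  rcases eq_bot_or_eq_top_of_polarization (p := p) (2 * k) hm hk W₁ (hstab 0 1 (by decide))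
    (hstab 1 0 (by decide)) with h | h
  · exact Or.inl h
  · right
    rwa [h, top_inf_eq] at hinf

end FormsBracket

/-! ### The group for `V_m` and the theorem -/

section FormsGroup

variable (p : ℕ) [Fact p.Prime] {k : ℕ}

/-- The transvectant product of `V_m` over the field of `p` elements, as an extension. -/
noncomputable def formsExtension (hp : p ≠ 2) (hk : Odd k) :
    BracketExtension p (Fin (2 * k + 1) → ZMod (p ^ 2)) (Forms (ZMod p) (2 * k)) :=
  homocyclicExtension (formsBasis (ZMod p) (2 * k))
    (LinearMap.toAddMonoidHom'.comp (formsBracket (ZMod p) k).toAddMonoidHom) fun v =>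
    formsBracket_self hk (Ring.two_ne_zero (by rwa [ringChar.eq (ZMod p) p])) v

theorem exists_mulEquiv_slForms (hp : p ≠ 2) (hk : Odd k)
    (A : Matrix.SpecialLinearGroup (Fin 2) (ZMod p)) :
    ∃ α : (formsExtension p hp hk).Grp ≃* (formsExtension p hp hk).Grp,
      ∀ x, (α x).cls = slForms (ZMod p) (2 * k) A x.cls := by
  have : NeZero (p ^ 2) := ⟨pow_ne_zero 2 (Fact.out : p.Prime).ne_zero⟩
  obtain ⟨α, hα⟩ := exists_lift_homocyclic (formsBasis (ZMod p) (2 * k))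
    (LinearMap.toAddMonoidHom'.comp (formsBracket (ZMod p) k).toAddMonoidHom) (fun v =>
      formsBracket_self hk (Ring.two_ne_zero (by rwa [ringChar.eq (ZMod p) p])) v)
    (slForms (ZMod p) (2 * k) A)
  exact BracketExtension.Grp.exists_mulEquiv (D := formsExtension p hp hk) α
    (slForms (ZMod p) (2 * k) A).toAddMonoidHom
    (Representation.apply_bijective (slForms (ZMod p) (2 * k)) A).injective hα
    (formsBracket_slForms k A)

theorem eq_bot_or_eq_top_of_addSubgroup (hk0 : k ≠ 0) (hkp : 2 * k + 1 < p)
    (U : AddSubgroup (Forms (ZMod p) (2 * k)))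
    (hU : ∀ A, ∀ u ∈ U, slForms (ZMod p) (2 * k) A u ∈ U) : U = ⊥ ∨ U = ⊤ := by
  refine (eq_bot_or_eq_top_of_slForms (by omega) hkp (AddSubgroup.toZModSubmodule p U) hU).imp ?_ ?_
  · exact (map_eq_bot_iff (AddSubgroup.toZModSubmodule p)).mp
  · exact (map_eq_top_iff (AddSubgroup.toZModSubmodule p)).mp

end FormsGroup

theorem mainTheorem11 (p : ℕ) [Fact p.Prime] (hp : 3 ≤ p) (m : ℕ) (hm : m ≡ 2 [MOD 4])
    (hmp : 2 * m < p) :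
    IsAbsolutelyIrreducible (slForms (ZMod p) m) ∧
    Module.finrank (ZMod p) (MvPolynomial.homogeneousSubmodule (Fin 2) (ZMod p) m) = m + 1 ∧
    ∃ (G : Type) (_ : Group G) (_ : Group.FG G),
      IsUCSPGroup p G ∧ Monoid.exponent G = p ^ 2 ∧ Group.rank G = m + 1 ∧
      (∃ e : Multiplicative (MvPolynomial.homogeneousSubmodule (Fin 2) (ZMod p) m) ≃*
          G ⧸ frattini G,
        ∀ A : Matrix.SpecialLinearGroup (Fin 2) (ZMod p),
          ∃ β ∈ (autFrattiniQuotient G).range,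
            ∀ v : MvPolynomial.homogeneousSubmodule (Fin 2) (ZMod p) m,
              β (e (Multiplicative.ofAdd v)) =
                e (Multiplicative.ofAdd (slForms (ZMod p) m A v))) ∧
      ∀ (H : Type*) [Group H] (k : ℕ),
        IsUCSPGroup p H → Nat.card H < Nat.card G → IsEmpty (G ≃* (Fin k → H)) := by
  have hm4 : m % 4 = 2 := hm
  obtain ⟨k, rfl⟩ : ∃ k, m = 2 * k := ⟨m / 2, by omega⟩
  have hk : Odd k := Nat.odd_iff.mpr (by omega)
  have hk0 : k ≠ 0 := hk.pos.ne'
  have hp2 : p ≠ 2 := by omega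
  have hpodd : Odd p := (Fact.out : p.Prime).odd_of_ne_two hp2
  have hNe : NeZero (p ^ 2) := ⟨pow_ne_zero 2 (Fact.out : p.Prime).ne_zero⟩
  have hV : Nontrivial (Forms (ZMod p) (2 * k)) :=
    ⟨_, 0, (formsBasis (ZMod p) (2 * k)).ne_zero 0⟩
  have hρ := exists_mulEquiv_slForms p hp2 hk
  have hirr := eq_bot_or_eq_top_of_addSubgroup p hk0 (by omega)
  refine ⟨isAbsolutelyIrreducible_slForms (by omega) (by omega), finrank_forms _ _,
    (formsExtension p hp2 hk).Grp, inferInstance, inferInstance, ⟨inferInstance,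
      BracketExtension.Grp.isPGroup, BracketExtension.Grp.isUCS _ hρ hirr⟩,
    BracketExtension.Grp.exponent_eq, BracketExtension.Grp.rank_eq (formsBasis (ZMod p) (2 * k)),
    ?_, ?_⟩
  · obtain ⟨e, he⟩ := BracketExtension.Grp.exists_frattiniQuotient_equiv _ hρ hirr
    refine ⟨e, fun A => ?_⟩
    obtain ⟨α, hα⟩ := hρ A
    refine ⟨_, ⟨α, rfl⟩, fun v => ?_⟩
    obtain ⟨x, rfl⟩ := BracketExtension.Grp.exists_cls_eq (D := formsExtension p hp2 hk) v
    rw [he, ← hα, he]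
    rfl
  · intro H _ n _ hcard
    refine ⟨fun φ => ?_⟩
    have hG : Nontrivial (formsExtension p hp2 hk).Grp :=
      BracketExtension.Grp.central_injective.nontrivial
    have hHnt : Nontrivial H := by
      by_contra h
      rw [not_nontrivial_iff_subsingleton] at h
      exact not_subsingleton _ φ.toEquiv.subsingleton
    -- Exponent `0` gives a trivial group, exponent `1` contradicts the orders, and a larger
    -- exponent splits off one factor `H`.
    obtain _ | _ | n := n
    · exact not_subsingleton _ φ.toEquiv.subsingleton
    · exact hcard.ne' (Nat.card_congr (φ.toEquiv.trans (Equiv.funUnique (Fin 1) H)))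
    · let ψ : (Fin (n + 1 + 1) → H) ≃* H × (Fin (n + 1) → H) :=
        { (Fin.consEquiv fun _ => H).symm with map_mul' := fun _ _ => rfl }
      rcases BracketExtension.Grp.subsingleton_of_mulEquiv_prod hpodd
        (fun W₁ W₂ hsup hinf h₁₂ h₁ h₂ => by
        have := eq_bot_or_eq_bot_of_ideals (F := ZMod p) (Fact.out : p.Prime) hk (by omega)
          (W₁ := AddSubgroup.toZModSubmodule p W₁) (W₂ := AddSubgroup.toZModSubmodule p W₂)
          (by rw [← map_sup, hsup, map_top]) (by rw [← map_inf, hinf, map_bot]) h₁₂ h₁ h₂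
        exact this.imp (map_eq_bot_iff (AddSubgroup.toZModSubmodule p)).mp
          (map_eq_bot_iff (AddSubgroup.toZModSubmodule p)).mp) (φ.trans ψ) with h | h
      · exact not_subsingleton H h
      · exact not_subsingleton (Fin (n + 1) → H) h
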